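/- Let $G$ be a finite abelian group and $R$ a commutative ring. All algebras are commutative and unital. A unital partial action $\alpha_G=(S_g,\alpha_g)_{g\in G}$ of $G$ on an $R$-algebra $S$ consists of ideals $S_g=S1_g$ generated by idempotents $1_g$ and $R$-algebra isomorphisms $\alpha_g:S_{g^{-1}}\to S_g$ such that $S_1=S$, $\alpha_1=\mathrm{id}_S$, $\alpha_g(S_{g^{-1}}\cap S_h)=S_g\cap S_{gh}$ and $\alpha_g\alpha_h(x)=\alpha_{gh}(x)$ for $x\in\alpha_h^{-1}(S_h\cap S_{g^{-1}})$; it is global if $S_g=S$ for all $g$. For a subgroup $H$ put $S^{\alpha_H}=\{s\in S:\alpha_h(s1_{h^{-1}})=s1_h\ \forall h\in H\}$. $S$ is a partial Galois ($\alpha_G$-)extension of $R$ if $R\to S$ is injective with image $S^{\alpha_G}$ and there are $x_i,y_i\in S$ $(1\le i\le m)$ with $\sum_i x_i\alpha_g(y_i1_{g^{-1}})=\delta_{1,g}$ for all $g\in G$; if $\alpha_G$ is global, $S$ is then a global Galois $G$-extension of $R$. A partial action of a finite group $\Gamma$ on $S$ and a normal subgroup $H$ induce a partial action of $\Gamma/H$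 on $S^{\alpha_H}$: if $gH=\{a_1,\dots,a_m\}$, then $gH$ has idempotent $\sum_i\prod_{j<i}(1-1_{a_j})1_{a_i}$ and acts by $x\mapsto\sum_i\prod_{j<i}(1-1_{a_j})\,\alpha_{a_i}(x1_{a_i^{-1}})$. Let $\delta G=\{(g,g^{-1}):g\in G\}\le G\times G$ and identify $G$ with $(G\times G)/\delta G$ by $g\mapsto(g,1)\delta G$. Let $G\times G$ act partially on $\hat S=\prod_{g\in G}S_g$ by $\gamma$, where $\gamma_{(h,l)}$ sends $(a_g1_{h^{-1}}1_{lg})_g$ to the family whose component at $t=hlg$ is $\alpha_h(a_g1_{h^{-1}})1_t$. Put $E(S,\alpha_G)=\hat S^{\gamma_{\delta G}}$, with the induced partial action $\tilde\gamma_G$ of $G\cong(G\times G)/\delta G$. Write $\lfloor S,\alpha_G\rfloor$ for the class of $(S,\alpha_G)$ under $R$-algebra isomorphisms that carry $S_g$ onto $S'_g$ and $\alpha_g$ to $\alpha'_g$ for all $g$, and let $T_{par}(G,R)$ be the set of classes of partial Galois extensions of $R$. Put $\lfloor S,\alpha_G\rfloor^{*}=\lfloor S,\alpha^*_G\rfloor$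 with $S^*_g=S_{g^{-1}}$, $\alpha^*_g=\alpha_{g^{-1}}$; let $\lfloor S,\alpha_G\rfloor*\lfloor S',\alpha'_G\rfloor$ be the class of $(S\otimes_RS')^{(\alpha\otimes\alpha')_{\delta G}}$ with the induced partial action of $G\cong(G\times G)/\delta G$; and put $I(S,\alpha_G)=\lfloor E(S,\alpha_G),\tilde\gamma_G\rfloor$. For a class $\xi$ let $T_\xi(G,R)=\{x\in T_{par}(G,R): x^{*}*x=\xi\}$. Finally let $E_G(R)=\bigoplus_{g\in G}Re_g$, with orthogonal idempotents $e_g$ of sum $1$ and the global action $\rho_g(re_h)=re_{gh}$. **Proposition.** Let $(S,\alpha_G)$ be a unital partial action of $G$ such that $S$ is a partial Galois $\alpha_G$-extension of $R$, and suppose that for every $g\in G$ the only $r\in R$ with $r1_g=0$ is $r=0$. Then $E(S,\alpha_G)$, with $\tilde\gamma_G$, is a global Galois $G$-extension of $R$. Moreover $I(S,\alpha_G)=I(E_G(R),\rho_G)$, and $\lfloor S,\alpha_G\rfloor\in T_{I(E_G(R),\rho_G)}(G,R)$. -/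

import Mathlib

open scoped TensorProduct

universe u

/-! ## Partial actions -/

/-- A partial action of a group `G` on a commutative `R`-algebra `S`: ideals `D g` and
`R`-algebra isomorphisms `act g : D g⁻¹ → D g`. -/
structure PartialAction (R G S : Type u) [CommRing R] [Group G] [CommRing S] [Algebra R S] where
  D : G → Ideal S
  act : ∀ g, D g⁻¹ ≃ₗ[R] D g
  act_mul : ∀ g (x y : D g⁻¹), ((act g ((x : S) • y) : D g) : S) = (act g x : S) * (act g y : S)
  D_one : D 1 = ⊤
  act_one : ∀ x : D 1⁻¹, ((act 1 x : D 1) : S) = x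
  image_inter : ∀ g h, {y : S | ∃ x : D g⁻¹, (x : S) ∈ D h ∧ ((act g x : D g) : S) = y}
    = ((D g ⊓ D (g * h) : Ideal S) : Set S)
  act_act : ∀ g h (x : D h⁻¹) (hx : ((act h x : D h) : S) ∈ D g⁻¹),
    ∃ hx' : (x : S) ∈ D (g * h)⁻¹,
      ((act g ⟨(act h x : S), hx⟩ : D g) : S) = (act (g * h) ⟨x, hx'⟩ : S)

/-- A unital partial action: every ideal `D g` is generated by an idempotent `one g`
(written `1_g` in comments; it is uniquely determined by `D g`). -/
structure UnitalPartialAction (R G S : Type u) [CommRing R] [Group G] [CommRing S] [Algebra R S]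
    extends PartialAction R G S where
  one : G → S
  idem : ∀ g, IsIdempotentElem (one g)
  D_eq : ∀ g, D g = Ideal.span {one g}

namespace UnitalPartialAction

section Basic

variable {R G S : Type u} [CommRing R] [Group G] [CommRing S] [Algebra R S]
  (α : UnitalPartialAction R G S)

theorem mem_D {g : G} {x : S} : x ∈ α.D g ↔ x * α.one g = x := by
  rw [α.D_eq, Ideal.mem_span_singleton]
  constructor
  · rintro ⟨c, rfl⟩
    have := (α.idem g).eq
    linear_combination c * this
  · intro h
    exact ⟨x, by rw [mul_comm, h]⟩

theorem mul_one_mem (g : G) (x : S) : x * α.one g ∈ α.D g := by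
  rw [mem_D, mul_assoc, (α.idem g).eq]

/-- The everywhere defined map `s ↦ α_g(s 1_{g⁻¹})`. -/
def tot (g : G) : S →ₗ[R] S where
  toFun s := (α.act g ⟨s * α.one g⁻¹, α.mul_one_mem g⁻¹ s⟩ : S)
  map_add' x y := by
    have : (⟨(x + y) * α.one g⁻¹, α.mul_one_mem g⁻¹ (x + y)⟩ : α.D g⁻¹)
      = ⟨x * α.one g⁻¹, α.mul_one_mem g⁻¹ x⟩ + ⟨y * α.one g⁻¹, α.mul_one_mem g⁻¹ y⟩ :=
      Subtype.ext (add_mul _ _ _)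
    rw [this, map_add]; rfl
  map_smul' r x := by
    have : (⟨(r • x) * α.one g⁻¹, α.mul_one_mem g⁻¹ (r • x)⟩ : α.D g⁻¹)
      = r • ⟨x * α.one g⁻¹, α.mul_one_mem g⁻¹ x⟩ := Subtype.ext (smul_mul_assoc _ _ _)
    rw [this, map_smul]; rfl

theorem tot_apply (g : G) (s : S) :
    α.tot g s = (α.act g ⟨s * α.one g⁻¹, α.mul_one_mem g⁻¹ s⟩ : S) := rfl

theorem tot_of_mem {g : G} {s : S} (hs : s ∈ α.D g⁻¹) : α.tot g s = (α.act g ⟨s, hs⟩ : S) := by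
  rw [tot_apply]
  congr 2
  exact Subtype.ext (α.mem_D.1 hs)

theorem tot_mul_one (g : G) (s : S) : α.tot g (s * α.one g⁻¹) = α.tot g s := by
  rw [tot_of_mem α (α.mul_one_mem g⁻¹ s), tot_apply]

theorem tot_mem (g : G) (s : S) : α.tot g s ∈ α.D g := (α.act g _).2

theorem tot_mul_self (g : G) (s : S) : α.tot g s * α.one g = α.tot g s :=
  α.mem_D.1 (α.tot_mem g s)

theorem tot_mul (g : G) (x y : S) : α.tot g (x * y) = α.tot g x * α.tot g y := by
  rw [tot_apply, tot_apply, tot_apply, ← α.act_mul]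
  congr 2
  refine Subtype.ext ?_
  have := (α.idem g⁻¹).eq
  simp only [SetLike.val_smul, smul_eq_mul]
  linear_combination (-x * y) * this

theorem exists_tot {g : G} {y : S} (hy : y ∈ α.D g) : ∃ x ∈ α.D g⁻¹, α.tot g x = y :=
  ⟨((α.act g).symm ⟨y, hy⟩ : S), Subtype.prop _, by
    rw [tot_of_mem α (Subtype.prop _)]; simp⟩

theorem tot_one (g : G) : α.tot g 1 = α.one g := by
  obtain ⟨x, -, hx⟩ := α.exists_tot (g := g) (y := α.one g) (α.mem_D.2 (α.idem g).eq)
  have h1 := α.tot_mul g x 1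
  rw [mul_one, hx] at h1
  rw [h1, mul_comm, tot_mul_self]

theorem one_one : α.one 1 = 1 := by
  have : (1 : S) ∈ α.D 1 := by rw [α.D_one]; trivial
  simpa using α.mem_D.1 this

theorem tot_id (s : S) : α.tot 1 s = s := by
  have : s ∈ α.D 1⁻¹ := by rw [inv_one, α.D_one]; trivial
  rw [tot_of_mem α this, α.act_one]

theorem tot_one_mul (g h : G) : α.tot g (α.one h) = α.one (g * h) * α.one g := by
  have key : ∀ y : S, y ∈ (α.D g ⊓ α.D (g * h) : Ideal S) ↔
      ∃ x : α.D g⁻¹, (x : S) ∈ α.D h ∧ ((α.act g x : α.D g) : S) = y := by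
    intro y
    have := α.image_inter g h
    exact (Set.ext_iff.1 this y).symm
  have e1 : α.tot g (α.one h) * α.one (g * h) = α.tot g (α.one h) := by
    have := (key (α.tot g (α.one h))).2 ⟨⟨α.one h * α.one g⁻¹, α.mul_one_mem _ _⟩, ?_, rfl⟩
    · exact α.mem_D.1 this.2
    · show α.one h * α.one g⁻¹ ∈ α.D h
      rw [mul_comm]; exact α.mul_one_mem _ _
  obtain ⟨x, hx, hx'⟩ := (key (α.one (g * h) * α.one g)).1
    ⟨α.mul_one_mem _ _, by rw [mul_comm]; exact α.mul_one_mem _ _⟩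
  rw [← α.tot_of_mem x.2] at hx'
  have e2 := α.tot_mul g x (α.one h)
  rw [α.mem_D.1 hx, hx'] at e2
  have e3 := α.tot_mul_self g (α.one h)
  linear_combination -e1 - α.one (g * h) * e3 - e2

theorem tot_tot (g h : G) (s : S) : α.tot g (α.tot h s) = α.tot (g * h) s * α.one g := by
  set x : S := s * α.one (g * h)⁻¹ * α.one h⁻¹ with hx
  have hxm : x ∈ α.D h⁻¹ := α.mul_one_mem _ _
  have e1 : α.tot h x = α.tot h s * α.one g⁻¹ := by
    rw [hx, tot_mul_one, tot_mul, tot_one_mul, mul_inv_rev, mul_inv_cancel_left]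
    have := α.tot_mul_self h s
    linear_combination α.one g⁻¹ * this
  have hm : ((α.act h ⟨x, hxm⟩ : α.D h) : S) ∈ α.D g⁻¹ := by
    rw [← α.tot_of_mem hxm, e1]; exact α.mul_one_mem _ _
  obtain ⟨hx', h'⟩ := α.act_act g h ⟨x, hxm⟩ hm
  rw [← α.tot_of_mem hm, ← α.tot_of_mem hx', ← α.tot_of_mem hxm, e1, tot_mul_one] at h'
  rw [h']
  show α.tot (g * h) (s * α.one (g * h)⁻¹ * α.one h⁻¹) = _
  rw [mul_right_comm, tot_mul_one, tot_mul, tot_one_mul, mul_inv_cancel_right]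
  have := α.tot_mul_self (g * h) s
  linear_combination α.one g * this

/-- A unital partial action is the same as a family of multiplicative linear maps
`f g : S → S` with `f 1 = id` and `f g (f h s) = f (g h) s * f g 1`; here `f g s` is
`α_g(s 1_{g⁻¹})`, `1_g = f g 1`, and the isomorphisms are the restrictions of the `f g`. -/
def ofTotal (f : G → S →ₗ[R] S) (hmul : ∀ g x y, f g (x * y) = f g x * f g y)
    (hone : ∀ s, f 1 s = s) (hcomp : ∀ g h s, f g (f h s) = f (g * h) s * f g 1) :
    UnitalPartialAction R G S :=
  have hself : ∀ g s, f g s * f g 1 = f g s := fun g s => by rw [← hmul, mul_one]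
  have hinv : ∀ g s, f g (f g⁻¹ s) = s * f g 1 := fun g s => by
    rw [hcomp, mul_inv_cancel, hone]
  have hinv' : ∀ g s, f g⁻¹ (f g s) = s * f g⁻¹ 1 := fun g s => by
    rw [hcomp, inv_mul_cancel, hone]
  have hD : ∀ g x, x ∈ Ideal.span {f g 1} ↔ x * f g 1 = x := fun g x => by
    rw [Ideal.mem_span_singleton]
    constructor
    · rintro ⟨c, rfl⟩
      linear_combination c * hself g 1
    · intro h
      exact ⟨x, by rw [mul_comm, h]⟩
  have hmem : ∀ g s, f g s ∈ Ideal.span {f g 1} := fun g s => (hD _ _).2 (hself g s)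
  { D := fun g => Ideal.span {f g 1}
    act := fun g =>
      { toFun := fun x => ⟨f g x, hmem g x⟩
        map_add' := fun x y => Subtype.ext (map_add _ _ _)
        map_smul' := fun r x => Subtype.ext (map_smul (f g) r (x : S))
        invFun := fun y => ⟨f g⁻¹ y, hmem g⁻¹ y⟩
        left_inv := fun x => Subtype.ext ((hinv' g x).trans ((hD _ _).1 x.2))
        right_inv := fun y => Subtype.ext ((hinv g y).trans ((hD _ _).1 y.2)) }
    act_mul := fun g x y => hmul g x y
    D_one := by rw [hone]; exact Ideal.span_singleton_one
    act_one := fun x => hone x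
    image_inter := by
      intro g h
      ext y
      constructor
      · rintro ⟨x, hx, rfl⟩
        refine ⟨hmem g x, (hD _ _).2 ?_⟩
        have e := congrArg (f g) ((hD _ _).1 hx)
        rw [hmul, hcomp] at e
        show f g x * f (g * h) 1 = f g x
        linear_combination e - f (g * h) 1 * hself g x
      · rintro ⟨hy, hy'⟩
        refine ⟨⟨f g⁻¹ y, hmem _ _⟩, (hD _ _).2 ?_, (hinv g y).trans ((hD _ _).1 hy)⟩
        have e := congrArg (f g⁻¹) ((hD _ _).1 hy')
        rw [hmul, hcomp, inv_mul_cancel_left] at e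
        show f g⁻¹ y * f h 1 = f g⁻¹ y
        linear_combination e - f h 1 * hself g⁻¹ y
    act_act := by
      rintro g h ⟨x, hx⟩ hx'
      have hxg : x ∈ Ideal.span {f (g * h)⁻¹ 1} := by
        have e := congrArg (f h⁻¹) ((hD _ _).1 hx')
        change f h⁻¹ (f h x * f g⁻¹ 1) = f h⁻¹ (f h x) at e
        rw [hmul, hinv', (hD _ _).1 hx, hcomp, ← mul_inv_rev] at e
        refine (hD _ _).2 ?_
        have e' := (hD _ _).1 hx
        linear_combination e - f (g * h)⁻¹ 1 * e'
      refine ⟨hxg, ?_⟩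
      have e' := congrArg (f (g * h)) ((hD _ _).1 hx)
      rw [hmul, hcomp, mul_inv_cancel_right] at e'
      show f g (f h x) = f (g * h) x
      rw [hcomp]
      linear_combination e' - f g 1 * hself (g * h) x
    one := fun g => f g 1
    idem := fun g => hself g 1
    D_eq := fun g => rfl }

theorem ofTotal_tot (f : G → S →ₗ[R] S) (hmul : ∀ g x y, f g (x * y) = f g x * f g y)
    (hone : ∀ s, f 1 s = s) (hcomp : ∀ g h s, f g (f h s) = f (g * h) s * f g 1) (g : G) (s : S) :
    (ofTotal f hmul hone hcomp).tot g s = f g s := by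
  have h1 : (ofTotal f hmul hone hcomp).tot g s = f g (s * f g⁻¹ 1) := rfl
  rw [h1, hmul, hcomp, mul_inv_cancel, hone, one_mul, ← hmul, mul_one]

/-- The action is global: all the ideals are the whole algebra. -/
def IsGlobal : Prop := ∀ g, α.D g = ⊤

/-- The subalgebra `S^{α_H}` of invariants under the restriction of the partial action to `H`:
the `s` with `α_h(s 1_{h⁻¹}) = s 1_h` for all `h ∈ H`. -/
def invariants (H : Subgroup G) : Subalgebra R S where
  carrier := {s | ∀ h ∈ H, α.tot h s = s * α.one h}
  mul_mem' {a b} ha hb h hh := by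
    have := (α.idem h).eq
    rw [tot_mul, ha h hh, hb h hh]
    linear_combination (a * b) * this
  add_mem' {a b} ha hb h hh := by rw [map_add, ha h hh, hb h hh, add_mul]
  algebraMap_mem' r h hh := by
    rw [Algebra.algebraMap_eq_smul_one, map_smul, tot_one, smul_mul_assoc, one_mul]

/-- `S` is a partial Galois extension of `R` with respect to `α`: the structure map identifies `R`
with the subalgebra of invariants, and there are partial Galois coordinates
`∑ i, x i * α_g(y i 1_{g⁻¹}) = δ_{1,g}`. -/
def IsPartialGalois : Prop :=
  Function.Injective (algebraMap R S) ∧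
  (∀ s : S, s ∈ α.invariants ⊤ ↔ s ∈ Set.range (algebraMap R S)) ∧
  ∃ (m : ℕ) (x y : Fin m → S), ∀ g : G,
    (g = 1 → ∑ i, x i * α.tot g (y i) = 1) ∧ (g ≠ 1 → ∑ i, x i * α.tot g (y i) = 0)

/-- Pullback of a partial action along a group homomorphism. -/
def comap {G' : Type u} [Group G'] (f : G' →* G) : UnitalPartialAction R G' S :=
  ofTotal (fun g => α.tot (f g)) (fun g => α.tot_mul (f g))
    (fun s => by rw [map_one, tot_id]) (fun g h s => by rw [tot_tot, map_mul, tot_one])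

/-! ### Isomorphism of partial actions -/

/-- `R`-linear partial `G`-isomorphism: an isomorphism of `R`-algebras `φ` with `φ(S_g) = S'_g`
that intertwines the maps `α_g` and `α'_g`. -/
def Iso {S' : Type u} [CommRing S'] [Algebra R S'] (α : UnitalPartialAction R G S)
    (α' : UnitalPartialAction R G S') : Prop :=
  ∃ φ : S ≃ₐ[R] S', ∃ hD : ∀ g s, s ∈ α.D g ↔ φ s ∈ α'.D g,
    ∀ g (s : S) (hs : s ∈ α.D g⁻¹),
      φ (α.act g ⟨s, hs⟩ : S) = (α'.act g ⟨φ s, (hD g⁻¹ s).1 hs⟩ : S')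

theorem iso_iff {S' : Type u} [CommRing S'] [Algebra R S'] (α : UnitalPartialAction R G S)
    (α' : UnitalPartialAction R G S') :
    α.Iso α' ↔ ∃ φ : S ≃ₐ[R] S', ∀ g s, φ (α.tot g s) = α'.tot g (φ s) := by
  constructor
  · rintro ⟨φ, hD, h⟩
    refine ⟨φ, fun g s => ?_⟩
    have hone : ∀ g, φ (α.one g) = α'.one g := fun g => by
      have h1 := α'.mem_D.1 ((hD g _).1 (α.mem_D.2 (α.idem g).eq))
      have h2 := α.mem_D.1 ((hD g (φ.symm (α'.one g))).2 (by
        rw [AlgEquiv.apply_symm_apply]; exact α'.mem_D.2 (α'.idem g).eq))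
      have h3 := congrArg φ h2
      rw [map_mul, AlgEquiv.apply_symm_apply] at h3
      rw [← h1, mul_comm, h3]
    rw [← α.tot_mul_one, ← α'.tot_mul_one, ← hone, ← map_mul,
      α.tot_of_mem (α.mul_one_mem g⁻¹ s), h,
      α'.tot_of_mem ((hD g⁻¹ _).1 (α.mul_one_mem g⁻¹ s))]
  · rintro ⟨φ, h⟩
    have hone : ∀ g, φ (α.one g) = α'.one g := fun g => by
      rw [← tot_one, h, map_one, tot_one]
    refine ⟨φ, fun g s => ?_, fun g s hs => ?_⟩
    · rw [mem_D, mem_D, ← hone, ← map_mul, φ.injective.eq_iff]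
    · rw [← α.tot_of_mem hs, h, ← α'.tot_of_mem]

/-! ### The induced partial action of a quotient group -/

/-- For a list `a₁, …, aₙ` of group elements, the map
`s ↦ ∑ i, (∏ j < i, (1 - 1_{a_j})) α_{a_i}(s 1_{a_i⁻¹})`. -/
def glue : List G → (S →ₗ[R] S)
  | [] => 0
  | a :: L => α.tot a + (LinearMap.mulLeft R (1 - α.one a)).comp (glue L)

theorem glue_cons (a : G) (L : List G) (s : S) :
    α.glue (a :: L) s = α.tot a s + (1 - α.one a) * α.glue L s := rfl

theorem glue_mul (L : List G) (x y : S) : α.glue L (x * y) = α.glue L x * α.glue L y := by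
  induction L with
  | nil => simp [glue]
  | cons a L ih =>
    rw [glue_cons, glue_cons, glue_cons, ih, tot_mul]
    have h1 := α.tot_mul_self a x
    have h2 := α.tot_mul_self a y
    have h3 := (α.idem a).eq
    linear_combination (α.glue L y) * h1 + (α.glue L x) * h2 - (α.glue L x * α.glue L y) * h3

theorem glue_mul_glue_one (L : List G) (x : S) : α.glue L x * α.glue L 1 = α.glue L x := by
  rw [← glue_mul, mul_one]

theorem glue_one_mul_one {L : List G} {a : G} (ha : a ∈ L) :
    α.glue L 1 * α.one a = α.one a := by
  induction L with
  | nil => simp at ha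
  | cons b L ih =>
    rw [glue_cons, tot_one]
    rcases List.mem_cons.1 ha with rfl | h
    · have h3 := (α.idem a).eq
      linear_combination (1 - α.glue L 1) * h3
    · linear_combination (1 - α.one b) * ih h

/-- A multiple of `α.glue L 1` is determined by its products with the `1_a`, `a ∈ L`. -/
theorem glue_ext {L : List G} {x y : S} (hx : x * α.glue L 1 = x) (hy : y * α.glue L 1 = y)
    (h : ∀ a ∈ L, x * α.one a = y * α.one a) : x = y := by
  have key : ∀ L : List G, (∀ a ∈ L, x * α.one a = y * α.one a) →
      x * α.glue L 1 = y * α.glue L 1 := by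
    intro L hL
    induction L with
    | nil => simp [glue]
    | cons b L ih =>
      rw [glue_cons, tot_one]
      have h1 := hL b (by simp)
      have h2 := ih fun a ha => hL a (by simp [ha])
      linear_combination h1 + (1 - α.one b) * h2
  rw [← hx, ← hy]
  exact key L h

/-- `α_h` shifts `glue`. -/
theorem tot_glue (h : G) (L : List G) (x : S) :
    α.tot h (α.glue L x) = α.glue (L.map (h * ·)) x * α.one h := by
  induction L with
  | nil => simp [glue]
  | cons a L ih =>
    rw [List.map_cons, glue_cons, glue_cons, map_add, tot_mul, map_sub, tot_one, tot_one_mul,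
      tot_tot, ih]
    have h3 := (α.idem h).eq
    linear_combination (α.glue (L.map (h * ·)) x - α.one (h * a) * α.glue (L.map (h * ·)) x) * h3

section Quotient

variable {H : Subgroup G}

/-- On invariants, the pieces `α_a(x 1_{a⁻¹})` for `a` in a coset of `H` are compatible. -/
theorem tot_compat {x : S} (hx : x ∈ α.invariants H) {a b : G}
    (hab : (a : G ⧸ H) = (b : G ⧸ H)) : α.tot a x * α.one b = α.tot b x * α.one a := by
  obtain ⟨h, hh, rfl⟩ : ∃ h ∈ H, b = a * h := ⟨a⁻¹ * b, QuotientGroup.eq.1 hab, by group⟩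
  rw [← tot_tot, hx h hh, tot_mul, tot_one_mul]
  have := α.tot_mul_self a x
  linear_combination -α.one (a * h) * this

theorem glue_mul_one {x : S} (hx : x ∈ α.invariants H) {L : List G} {a : G} (ha : a ∈ L)
    (hL : ∀ b ∈ L, (b : G ⧸ H) = (a : G ⧸ H)) : α.glue L x * α.one a = α.tot a x := by
  induction L with
  | nil => simp at ha
  | cons b L ih =>
    rw [glue_cons]
    have hb := α.tot_compat hx (hL b (by simp))
    rcases List.mem_cons.1 ha with rfl | h
    · have h3 := (α.idem a).eq
      have h4 := α.tot_mul_self a x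
      linear_combination h4 - α.glue L x * h3
    · have e := ih h fun c hc => hL c (by simp [hc])
      linear_combination hb + (1 - α.one b) * e

theorem glue_congr {x : S} (hx : x ∈ α.invariants H) {q : G ⧸ H} {L L' : List G}
    (hL : ∀ a, a ∈ L ↔ (a : G ⧸ H) = q) (hL' : ∀ a, a ∈ L' ↔ (a : G ⧸ H) = q) :
    α.glue L x = α.glue L' x := by
  have key : ∀ {y : S}, y ∈ α.invariants H → ∀ a ∈ L, α.glue L y * α.one a
      = α.glue L' y * α.one a := by
    intro y hy a ha
    have hq := (hL a).1 ha
    rw [α.glue_mul_one hy ha fun b hb => ((hL b).1 hb).trans hq.symm,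
      α.glue_mul_one hy ((hL' a).2 hq) fun b hb => ((hL' b).1 hb).trans hq.symm]
  have h1 : α.glue L 1 = α.glue L' 1 := by
    have e1 : α.glue L 1 = α.glue L 1 * α.glue L' 1 := by
      refine α.glue_ext (L := L) (α.glue_mul_glue_one L 1) ?_ fun a ha => ?_
      · linear_combination α.glue L' 1 * α.glue_mul_glue_one L 1
      · have := α.glue_one_mul_one ha
        have := α.glue_one_mul_one ((hL' a).2 ((hL a).1 ha))
        linear_combination -α.glue L 1 * this
    have e2 : α.glue L' 1 = α.glue L 1 * α.glue L' 1 := by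
      refine α.glue_ext (L := L') (α.glue_mul_glue_one L' 1) ?_ fun a ha => ?_
      · linear_combination α.glue L 1 * α.glue_mul_glue_one L' 1
      · have := α.glue_one_mul_one ha
        have := α.glue_one_mul_one ((hL a).2 ((hL' a).1 ha))
        linear_combination -α.glue L' 1 * this
    rw [e1, ← e2]
  refine α.glue_ext (α.glue_mul_glue_one L x) ?_ (key hx)
  rw [h1, glue_mul_glue_one]

variable [Finite G]

/-- The elements of a coset. -/
noncomputable def cosetList (q : G ⧸ H) : List G :=
  (Set.toFinite {a : G | (a : G ⧸ H) = q}).toFinset.toList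

theorem mem_cosetList (q : G ⧸ H) (a : G) : a ∈ cosetList q ↔ (a : G ⧸ H) = q := by
  simp [cosetList]

variable [H.Normal]

theorem glue_shift {x : S} (hx : x ∈ α.invariants H) (a : G) (q : G ⧸ H) :
    α.glue ((cosetList q).map (a * ·)) x = α.glue (cosetList ((a : G ⧸ H) * q)) x := by
  refine α.glue_congr hx (q := (a : G ⧸ H) * q) (fun b => ?_) (mem_cosetList _)
  rw [List.mem_map]
  constructor
  · rintro ⟨c, hc, rfl⟩
    rw [← (mem_cosetList q c).1 hc]; rfl
  · intro hb
    refine ⟨a⁻¹ * b, (mem_cosetList q _).2 ?_, by group⟩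
    rw [QuotientGroup.mk_mul, hb, QuotientGroup.mk_inv, inv_mul_cancel_left]

theorem glue_mem {x : S} (hx : x ∈ α.invariants H) (q : G ⧸ H) :
    α.glue (cosetList q) x ∈ α.invariants H := by
  intro h hh
  rw [tot_glue, α.glue_shift hx, (QuotientGroup.eq_one_iff h).2 hh, one_mul]

theorem glue_glue {x : S} (hx : x ∈ α.invariants H) (p q : G ⧸ H) :
    α.glue (cosetList p) (α.glue (cosetList q) x)
      = α.glue (cosetList (p * q)) x * α.glue (cosetList p) 1 := by
  refine α.glue_ext (α.glue_mul_glue_one _ _) ?_ fun a ha => ?_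
  · rw [mul_assoc, glue_mul_glue_one]
  · have hp := (mem_cosetList p a).1 ha
    rw [α.glue_mul_one (α.glue_mem hx q) ha
      fun b hb => ((mem_cosetList p b).1 hb).trans hp.symm, tot_glue, α.glue_shift hx, hp,
      mul_assoc, α.glue_one_mul_one ha]

theorem glue_one_coset {x : S} (hx : x ∈ α.invariants H) :
    α.glue (cosetList (1 : G ⧸ H)) x = x := by
  have h1 : (1 : G) ∈ cosetList (1 : G ⧸ H) := (mem_cosetList _ _).2 rfl
  have := α.glue_mul_one hx h1 fun b hb => (mem_cosetList _ b).1 hb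
  rwa [one_one, mul_one, tot_id] at this

/-- The partial action `α_{G/H}` of `G ⧸ H` on `S^{α_H}` induced by `α`: with
`g H = {a₁, …, aₘ}`, the idempotent of `g H` is `∑ i, (∏ j < i, (1 - 1_{a_j})) 1_{a_i}` and
`α_{gH}(x) = ∑ i, (∏ j < i, (1 - 1_{a_j})) α_{a_i}(x 1_{a_i⁻¹})`. The enumeration of the coset is
irrelevant by `glue_congr`. -/
noncomputable def quot (H : Subgroup G) [H.Normal] :
    UnitalPartialAction R (G ⧸ H) (α.invariants H) :=
  ofTotal
    (fun q =>
      { toFun := fun x => ⟨α.glue (cosetList q) x, α.glue_mem x.2 q⟩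
        map_add' := fun _ _ => Subtype.ext (map_add _ _ _)
        map_smul' := fun r x => Subtype.ext (map_smul (α.glue (cosetList q)) r (x : S)) })
    (fun _ _ _ => Subtype.ext (α.glue_mul _ _ _))
    (fun x => Subtype.ext (α.glue_one_coset x.2))
    (fun p q x => Subtype.ext (α.glue_glue x.2 p q))

theorem quot_tot (q : G ⧸ H) (x : α.invariants H) :
    (((α.quot H).tot q x : α.invariants H) : S) = α.glue (cosetList q) x :=
  congrArg Subtype.val (ofTotal_tot _ _ _ _ q x)

end Quotient

end Basic

section Abelian

variable {R G S S' : Type u} [CommRing R] [CommGroup G] [CommRing S] [Algebra R S]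
  [CommRing S'] [Algebra R S']

/-- The partial action `α*` with `S*_g = S_{g⁻¹}` and `α*_g = α_{g⁻¹}`. -/
def star (α : UnitalPartialAction R G S) : UnitalPartialAction R G S :=
  ofTotal (fun g => α.tot g⁻¹) (fun g => α.tot_mul g⁻¹)
    (fun s => by rw [inv_one, tot_id])
    (fun g h s => by rw [tot_tot, mul_inv, tot_one])

/-- The partial action `α ⊗ α'` of `G × G` on `S ⊗ S'`. -/
noncomputable def tensor (α : UnitalPartialAction R G S) (α' : UnitalPartialAction R G S') :
    UnitalPartialAction R (G × G) (S ⊗[R] S') :=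
  ofTotal (fun p => TensorProduct.map (α.tot p.1) (α'.tot p.2))
    (fun p x y => by
      induction x using TensorProduct.induction_on with
      | zero => simp
      | add a b ha hb => rw [add_mul, map_add, map_add, ha, hb, add_mul]
      | tmul a b =>
        induction y using TensorProduct.induction_on with
        | zero => simp
        | add c d hc hd => rw [mul_add, map_add, map_add, hc, hd, mul_add]
        | tmul c d => simp [tot_mul])
    (fun x => by
      induction x using TensorProduct.induction_on with
      | zero => simp
      | add a b ha hb => rw [map_add, ha, hb]
      | tmul a b => simp [tot_id])
    (fun p q x => by
      induction x using TensorProduct.induction_on with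
      | zero => simp
      | add a b ha hb => rw [map_add, map_add, ha, hb, map_add, add_mul]
      | tmul a b =>
        rw [Algebra.TensorProduct.one_def]
        simp [tot_tot, tot_one])

/-- `δG = {(g, g⁻¹)}`. -/
def delta (G : Type u) [CommGroup G] : Subgroup (G × G) where
  carrier := {p | ∃ g : G, p = (g, g⁻¹)}
  mul_mem' := by
    rintro _ _ ⟨g, rfl⟩ ⟨h, rfl⟩
    exact ⟨g * h, by simp [mul_comm]⟩
  one_mem' := ⟨1, Prod.ext rfl inv_one.symm⟩
  inv_mem' := by
    rintro _ ⟨g, rfl⟩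
    exact ⟨g⁻¹, by simp⟩

/-- The identification `G ≃ (G × G) ⧸ δG`, `g ↦ (g, 1) δG = (1, g) δG`. -/
noncomputable def toDelta (G : Type u) [CommGroup G] : G ≃* (G × G) ⧸ delta G :=
  MulEquiv.ofBijective ((QuotientGroup.mk' (delta G)).comp (MonoidHom.inl G G)) (by
    constructor
    · intro g h hgh
      obtain ⟨a, ha⟩ := QuotientGroup.eq.1
        (show (QuotientGroup.mk (g, 1) : (G × G) ⧸ delta G) = QuotientGroup.mk (h, 1) from hgh)
      simp only [Prod.inv_mk, inv_one, Prod.mk_mul_mk, mul_one, Prod.mk.injEq] at ha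
      have : a = 1 := by simpa using ha.2.symm
      rw [this] at ha
      exact (inv_mul_eq_one.1 ha.1)
    · intro q
      induction q using QuotientGroup.induction_on with
      | H p =>
        refine ⟨p.1 * p.2, (QuotientGroup.eq (s := delta G) (a := (p.1 * p.2, 1)) (b := p)).2
          ⟨p.2⁻¹, ?_⟩⟩
        ext <;> simp [mul_comm])

variable [Finite G]

/-- For a partial action of `G × G`, the partial action of `G ≃ (G × G) ⧸ δG` on the subalgebra of
invariants under `δG`. -/
noncomputable def descend (θ : UnitalPartialAction R (G × G) S) :
    UnitalPartialAction R G (θ.invariants (delta G)) :=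
  (θ.quot (delta G)).comap (toDelta G).toMonoidHom

/-- The product `((S ⊗ S')^{α_{δG}}, α_{(G × G)/δG})` of two partial actions. -/
noncomputable def par (α : UnitalPartialAction R G S) (α' : UnitalPartialAction R G S') :
    UnitalPartialAction R G ((α.tensor α').invariants (delta G)) :=
  (α.tensor α').descend

end Abelian

end UnitalPartialAction

/-! ## The algebra `E(S, α)` -/

/-- The corner ring `e S e` of an idempotent is an `R`-algebra. -/
instance cornerAlgebra {R S : Type u} [CommRing R] [CommRing S] [Algebra R S] {e : S}
    (he : IsIdempotentElem e) : Algebra R he.Corner where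
  smul r x := ⟨r • x.1, by
    obtain ⟨y, hy⟩ := x.2
    exact ⟨r • y, by rw [← hy]; simp⟩⟩
  algebraMap :=
    { toFun := fun r => ⟨e * algebraMap R S r * e, algebraMap R S r, rfl⟩
      map_one' := Subtype.ext (by
        show e * algebraMap R S 1 * e = e
        rw [map_one, mul_one, he.eq])
      map_mul' := fun r s => Subtype.ext (by
        show e * algebraMap R S (r * s) * e = e * algebraMap R S r * e * (e * algebraMap R S s * e)
        have h := he.eq
        rw [map_mul]
        linear_combination (-(algebraMap R S r * algebraMap R S s) * (e * e + e)) * h)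
      map_zero' := Subtype.ext (by
        show e * algebraMap R S 0 * e = 0
        simp)
      map_add' := fun r s => Subtype.ext (by
        show e * algebraMap R S (r + s) * e = e * algebraMap R S r * e + e * algebraMap R S s * e
        rw [map_add]; ring) }
  commutes' r x := mul_comm _ _
  smul_def' r x := Subtype.ext (by
    show r • x.1 = e * algebraMap R S r * e * x.1
    have hx : e * x.1 = x.1 := ((Subsemigroup.mem_corner_iff he).1 x.2).1
    rw [Algebra.smul_def]
    linear_combination (-algebraMap R S r) * hx - algebraMap R S r * e * hx)

namespace UnitalPartialAction

section Hat

variable {R G S : Type u} [CommRing R] [CommGroup G] [CommRing S] [Algebra R S]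
  (α : UnitalPartialAction R G S)

/-- `Ŝ = ∏_g S_g`, where `S_g = S 1_g` is a ring with identity element `1_g`. -/
abbrev Hat : Type u := ∀ g, (α.idem g).Corner

/-- The partial action `γ` of `G × G` on `Ŝ`: the component of `γ_{(h,l)}(a)` at `t = h l g` is
`α_h(a_g 1_{h⁻¹}) 1_t`. -/
def gamma : UnitalPartialAction R (G × G) α.Hat :=
  ofTotal
    (fun p =>
      { toFun := fun a t => ⟨α.one t * α.tot p.1 (a ((p.1 * p.2)⁻¹ * t)).1 * α.one t, _, rfl⟩
        map_add' := fun a b => funext fun t => Subtype.ext (by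
          show α.one t * α.tot p.1 ((a ((p.1 * p.2)⁻¹ * t)).1 + (b ((p.1 * p.2)⁻¹ * t)).1) * α.one t
            = α.one t * α.tot p.1 (a ((p.1 * p.2)⁻¹ * t)).1 * α.one t
              + α.one t * α.tot p.1 (b ((p.1 * p.2)⁻¹ * t)).1 * α.one t
          rw [map_add]; ring)
        map_smul' := fun r a => funext fun t => Subtype.ext (by
          show α.one t * α.tot p.1 (r • (a ((p.1 * p.2)⁻¹ * t)).1) * α.one t
            = r • (α.one t * α.tot p.1 (a ((p.1 * p.2)⁻¹ * t)).1 * α.one t)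
          rw [map_smul]; simp) })
    (fun p a b => funext fun t => Subtype.ext (by
      show α.one t * α.tot p.1 ((a ((p.1 * p.2)⁻¹ * t)).1 * (b ((p.1 * p.2)⁻¹ * t)).1) * α.one t
        = (α.one t * α.tot p.1 (a ((p.1 * p.2)⁻¹ * t)).1 * α.one t)
          * (α.one t * α.tot p.1 (b ((p.1 * p.2)⁻¹ * t)).1 * α.one t)
      rw [tot_mul]
      generalize α.tot p.1 (a ((p.1 * p.2)⁻¹ * t)).1 = A
      generalize α.tot p.1 (b ((p.1 * p.2)⁻¹ * t)).1 = B
      linear_combination (-(A * B) * (α.one t * α.one t + α.one t)) * (α.idem t).eq))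
    (fun a => funext fun t => Subtype.ext (by
      let F : G → S := fun t => (a t).1
      show α.one t * α.tot 1 (F ((1 * 1)⁻¹ * t)) * α.one t = F t
      have h1 : α.one t * F t = F t := ((Subsemigroup.mem_corner_iff (α.idem t)).1 (a t).2).1
      rw [tot_id, mul_one, inv_one, one_mul]
      linear_combination h1 + α.one t * h1))
    (fun p q a => funext fun t => Subtype.ext (by
      let F : G → S := fun t => (a t).1
      show α.one t * α.tot p.1 (α.one ((p.1 * p.2)⁻¹ * t)
          * α.tot q.1 (F ((q.1 * q.2)⁻¹ * ((p.1 * p.2)⁻¹ * t))) * α.one ((p.1 * p.2)⁻¹ * t))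
          * α.one t
        = (α.one t * α.tot (p.1 * q.1) (F ((p.1 * q.1 * (p.2 * q.2))⁻¹ * t)) * α.one t)
          * (α.one t * α.tot p.1 (α.one ((p.1 * p.2)⁻¹ * t)) * α.one t)
      have hidx : (q.1 * q.2)⁻¹ * ((p.1 * p.2)⁻¹ * t) = (p.1 * q.1 * (p.2 * q.2))⁻¹ * t := by
        rw [← mul_assoc, ← mul_inv, mul_mul_mul_comm, mul_comm q.1 p.1,
          mul_comm q.2 p.2]
      rw [hidx, tot_mul, tot_mul, tot_tot]
      have hw := α.tot_mul p.1 (α.one ((p.1 * p.2)⁻¹ * t)) (α.one ((p.1 * p.2)⁻¹ * t))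
      rw [(α.idem _).eq] at hw
      have hq := α.tot_mul_self p.1 (α.one ((p.1 * p.2)⁻¹ * t))
      have he := (α.idem t).eq
      generalize α.tot p.1 (α.one ((p.1 * p.2)⁻¹ * t)) = w at *
      generalize α.tot (p.1 * q.1) (F ((p.1 * q.1 * (p.2 * q.2))⁻¹ * t)) = X
      generalize α.one t = e at *
      linear_combination (e * e * X * w) * hq - (e * e * X) * hw
        - (X * w * (e * e + e)) * he))

theorem gamma_tot (p : G × G) (a : α.Hat) (t : G) :
    (α.gamma.tot p a t).1 = α.tot p.1 (a ((p.1 * p.2)⁻¹ * t)).1 * α.one t := by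
  rw [gamma, ofTotal_tot]
  show α.one t * α.tot p.1 (a ((p.1 * p.2)⁻¹ * t)).1 * α.one t = _
  linear_combination α.tot p.1 (a ((p.1 * p.2)⁻¹ * t)).1 * (α.idem t).eq

variable [Finite G]

/-- `E(S, α)`: the subalgebra of invariants of `Ŝ` under the restriction of `γ` to `δG`. -/
abbrev E : Type u := α.gamma.invariants (delta G)

/-- The partial action `γ̃` of `G ≃ (G × G) ⧸ δG` on `E(S, α)`. -/
noncomputable def gammaE : UnitalPartialAction R G α.E := α.gamma.descend

end Hat

/-- The trivial extension `E_G(R) = ⨁_g R e_g`, realised as functions `G → R`, with the global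
action `ρ_g (r e_h) = r e_{g h}`. -/
def rho (R G : Type u) [CommRing R] [CommGroup G] : UnitalPartialAction R G (G → R) :=
  ofTotal (fun g => LinearMap.funLeft R R (g⁻¹ * ·))
    (fun g x y => by ext t; simp [LinearMap.funLeft])
    (fun s => by ext t; simp [LinearMap.funLeft])
    (fun g h s => by ext t; simp [LinearMap.funLeft, mul_assoc])

theorem rho_tot {R G : Type u} [CommRing R] [CommGroup G] (g : G) (s : G → R) (t : G) :
    (rho R G).tot g s t = s (g⁻¹ * t) := by
  rw [rho, ofTotal_tot]; rfl

end UnitalPartialAction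

/-! ## Classes of partial actions and `T_par(G, R)` -/

/-- An `R`-algebra together with a unital partial action of `G`. -/
structure PAct (R G : Type u) [CommRing R] [CommGroup G] where
  carrier : Type u
  [ring : CommRing carrier]
  [algebra : Algebra R carrier]
  action : UnitalPartialAction R G carrier

attribute [instance] PAct.ring PAct.algebra

namespace PAct

open UnitalPartialAction

variable (R G : Type u) [CommRing R] [CommGroup G]

instance setoid : Setoid (PAct R G) where
  r X Y := X.action.Iso Y.action
  iseqv :=
    { refl := fun X => (iso_iff _ _).2 ⟨AlgEquiv.refl, fun _ _ => rfl⟩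
      symm := fun {X Y} h => by
        obtain ⟨φ, h⟩ := (iso_iff _ _).1 h
        refine (iso_iff _ _).2 ⟨φ.symm, fun g s => φ.injective ?_⟩
        rw [h]; simp
      trans := fun {X Y Z} h h' => by
        obtain ⟨φ, h⟩ := (iso_iff _ _).1 h
        obtain ⟨ψ, h'⟩ := (iso_iff _ _).1 h'
        exact (iso_iff _ _).2 ⟨φ.trans ψ, fun g s => by simp [h, h']⟩ }

end PAct

/-- Isomorphism classes of `R`-algebras with a unital partial action of `G`. -/
def PClass (R G : Type u) [CommRing R] [CommGroup G] : Type (u + 1) :=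
  Quotient (PAct.setoid R G)

namespace UnitalPartialAction

variable {R G : Type u} [CommRing R] [CommGroup G]

/-- The class `⌊S, α⌋`. -/
def cls {S : Type u} [CommRing S] [Algebra R S] (α : UnitalPartialAction R G S) : PClass R G :=
  Quotient.mk (PAct.setoid R G) ⟨S, α⟩

theorem star_iso {S T : Type u} [CommRing S] [Algebra R S] [CommRing T] [Algebra R T]
    {α : UnitalPartialAction R G S} {β : UnitalPartialAction R G T} (h : α.Iso β) :
    α.star.Iso β.star := by
  obtain ⟨φ, h⟩ := (iso_iff _ _).1 h
  refine (iso_iff _ _).2 ⟨φ, fun g s => ?_⟩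
  rw [star, star, ofTotal_tot, ofTotal_tot, h]

theorem glue_iso {G S T : Type u} [Group G] [CommRing S] [Algebra R S] [CommRing T] [Algebra R T]
    {α : UnitalPartialAction R G S} {β : UnitalPartialAction R G T} (φ : S ≃ₐ[R] T)
    (h : ∀ g s, φ (α.tot g s) = β.tot g (φ s)) (L : List G) (s : S) :
    φ (α.glue L s) = β.glue L (φ s) := by
  induction L with
  | nil => simp [glue]
  | cons a L ih =>
    rw [glue_cons, glue_cons, map_add, map_mul, map_sub, h, ih, map_one, ← tot_one, h, map_one,
      tot_one]

theorem descend_iso [Finite G] {S T : Type u} [CommRing S] [Algebra R S] [CommRing T]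
    [Algebra R T] {α : UnitalPartialAction R (G × G) S} {β : UnitalPartialAction R (G × G) T}
    (h : α.Iso β) : α.descend.Iso β.descend := by
  obtain ⟨φ, h⟩ := (iso_iff _ _).1 h
  have hone : ∀ g, φ (α.one g) = β.one g := fun g => by rw [← tot_one, h, map_one, tot_one]
  have hinv : ∀ s, s ∈ α.invariants (delta G) ↔ φ s ∈ β.invariants (delta G) := fun s => by
    refine forall_congr' fun g => imp_congr_right fun _ => ?_
    rw [← h, ← hone, ← map_mul, φ.injective.eq_iff]
  have hmap : (α.invariants (delta G)).map (φ : S →ₐ[R] T) = β.invariants (delta G) := by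
    ext t
    constructor
    · rintro ⟨s, hs, rfl⟩
      exact (hinv s).1 hs
    · intro ht
      exact ⟨φ.symm t, (hinv _).2 (by simpa using ht), by simp⟩
  refine (iso_iff _ _).2 ⟨(φ.subalgebraMap _).trans (Subalgebra.equivOfEq _ _ hmap),
    fun g s => Subtype.ext ?_⟩
  rw [descend, descend, comap, comap, ofTotal_tot, ofTotal_tot, quot_tot]
  refine Eq.trans ?_ (glue_iso φ h _ _)
  exact congrArg φ (quot_tot _ _ _)

theorem par_iso [Finite G] {S T S' T' : Type u} [CommRing S] [Algebra R S] [CommRing T]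
    [Algebra R T] [CommRing S'] [Algebra R S'] [CommRing T'] [Algebra R T']
    {α : UnitalPartialAction R G S} {β : UnitalPartialAction R G T}
    {α' : UnitalPartialAction R G S'} {β' : UnitalPartialAction R G T'}
    (h : α.Iso β) (h' : α'.Iso β') : (α.par α').Iso (β.par β') := by
  obtain ⟨φ, h⟩ := (iso_iff _ _).1 h
  obtain ⟨φ', h'⟩ := (iso_iff _ _).1 h'
  refine descend_iso ((iso_iff _ _).2 ⟨Algebra.TensorProduct.congr φ φ', fun g s => ?_⟩)
  rw [tensor, tensor, ofTotal_tot, ofTotal_tot]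
  induction s using TensorProduct.induction_on with
  | zero => simp
  | add a b ha hb => simp only [map_add, ha, hb]
  | tmul a b => simp [h, h']

end UnitalPartialAction

namespace PClass

open UnitalPartialAction

variable {R G : Type u} [CommRing R] [CommGroup G]

/-- `⌊S, α⌋* = ⌊S, α*⌋`. -/
def star (x : PClass R G) : PClass R G :=
  Quotient.map' (fun X : PAct R G => ⟨X.carrier, X.action.star⟩) (fun _ _ h => star_iso h) x

/-- `⌊S, α⌋ ∗ ⌊S', α'⌋ = ⌊(S ⊗ S')^{α_{δG}}, α_{(G × G)/δG}⌋`. -/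
noncomputable instance [Finite G] : Mul (PClass R G) where
  mul x y := Quotient.map₂
    (fun X Y : PAct R G => ⟨_, X.action.par Y.action⟩) (fun _ _ h _ _ h' => par_iso h h') x y

end PClass

/-- `T_par(G, R)`: the classes of partial Galois extensions of `R`. -/
def Tpar (R G : Type u) [CommRing R] [CommGroup G] : Set (PClass R G) :=
  {x | ∃ X : PAct R G, X.action.IsPartialGalois ∧ x = X.action.cls}

/-- `I(S, α) = ⌊E(S, α), γ̃⌋`. -/
noncomputable def idemClass {R G S : Type u} [CommRing R] [CommGroup G] [Finite G] [CommRing S]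
    [Algebra R S] (α : UnitalPartialAction R G S) : PClass R G :=
  α.gammaE.cls

/-- The component `T_ξ(G, R) = {x ∈ T_par(G, R) | x* ∗ x = ξ}`. -/
def Tcomp {R G : Type u} [CommRing R] [CommGroup G] [Finite G] (ξ : PClass R G) :
    Set (PClass R G) :=
  {x | x ∈ Tpar R G ∧ x.star * x = ξ}

/-! Everything rests on the partial trace tr(s) = ∑_g α_g(s 1_{g⁻¹}), which takes values in R. The
Galois coordinates give s = ∑ x_i tr(y_i s), so each S_t is finitely generated over R and S_t =
tr(S_t) S_t. As R acts faithfully on 1_t, Nakayama's lemma yields an element of S_t of trace 1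
(`exists_trace_eq_one`).

On δG the action γ does not move the index, so E(S, α) is cut out coordinate by coordinate.
Multiplying a_t by an element 1_t c of trace 1 shows a_t = tr(a_t c) 1_t: the elements of E(S, α)
are the families (r_t 1_t), and these form a copy of R^G. The action γ̃ translates the index, and
elements of trace 1 in the ideals S_{g t⁻¹} show that its idempotents are all 1. Hence E(S, α) ≅
E_G(R) (`rho_iso_gammaE`), which gives the Galois property and globality at once; the same result
applied to E_G(R) itself gives the equality of the two classes I.

Independently, x ⊗ y ↦ (α_t(x 1_{t⁻¹}) y)_t is the partial form of the classical isomorphism S ⊗ S ≅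
∏ S of Galois theory. It carries α* ⊗ α to γ with the two factors of G × G interchanged, and the
interchange becomes trivial modulo δG. So ⌊S, α⌋* ∗ ⌊S, α⌋ = I(S, α) (`star_par_iso_gammaE`). -/

namespace UnitalPartialAction

/-! ### The partial trace and elements of trace one -/

section Trace

variable {R G S : Type u} [CommRing R] [Group G] [Fintype G] [CommRing S] [Algebra R S]
  (α : UnitalPartialAction R G S)

/-- The partial trace `s ↦ ∑ g, α_g(s 1_{g⁻¹})`. -/
def trace : S →ₗ[R] S := ∑ g, α.tot g

theorem trace_apply (s : S) : α.trace s = ∑ g, α.tot g s := by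
  simp [trace]

/-- Composition with α_h sends the summand of g to that of h g, cut down by 1_h. -/
theorem trace_mem_invariants (s : S) : α.trace s ∈ α.invariants ⊤ := by
  intro h _
  rw [trace_apply, map_sum, Finset.sum_mul]
  simp_rw [tot_tot]
  exact Fintype.sum_equiv (Equiv.mulLeft h) _ _ fun g => rfl

theorem exists_trace_eq_algebraMap (hα : α.IsPartialGalois) (s : S) :
    ∃ r : R, algebraMap R S r = α.trace s :=
  (hα.2.1 _).1 (α.trace_mem_invariants s)

variable {m : ℕ} {x y : Fin m → S}

/-- The coordinates form a dual basis (x_i, tr(y_i ·)) of S over R: after expanding the trace, the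
Galois relations kill every summand except g = 1. -/
theorem sum_mul_trace
    (hxy : ∀ g : G, (g = 1 → ∑ i, x i * α.tot g (y i) = 1) ∧
      (g ≠ 1 → ∑ i, x i * α.tot g (y i) = 0)) (s : S) :
    ∑ i, x i * α.trace (y i * s) = s := by
  simp_rw [trace_apply, tot_mul, Finset.mul_sum]
  rw [Finset.sum_comm, Finset.sum_eq_single 1]
  · simp_rw [← mul_assoc]
    rw [← Finset.sum_mul, (hxy 1).1 rfl, one_mul, tot_id]
  · intro g _ hg
    simp_rw [← mul_assoc]
    rw [← Finset.sum_mul, (hxy g).2 hg, zero_mul]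
  · simp

-- Applying α_g to the relation for g⁻¹ exchanges the roles of x and y.
omit [Fintype G] in
theorem galois_coords_symm
    (hxy : ∀ g : G, (g = 1 → ∑ i, x i * α.tot g (y i) = 1) ∧
      (g ≠ 1 → ∑ i, x i * α.tot g (y i) = 0)) (g : G) :
    (g = 1 → ∑ i, y i * α.tot g (x i) = 1) ∧ (g ≠ 1 → ∑ i, y i * α.tot g (x i) = 0) := by
  constructor
  · rintro rfl
    simpa [tot_id, mul_comm] using (hxy 1).1 rfl
  · intro hg
    have h := congrArg (α.tot g) ((hxy g⁻¹).2 (inv_ne_one.2 hg))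
    rw [map_sum, map_zero] at h
    rw [← h]
    refine Finset.sum_congr rfl fun i _ => ?_
    rw [tot_mul, tot_tot, mul_inv_cancel, tot_id]
    linear_combination (-y i) * α.tot_mul_self g (x i)

/-- The trace is onto `R` already on an ideal `S_t` on which `R` acts faithfully. -/
theorem exists_trace_eq_one (hα : α.IsPartialGalois) (t : G)
    (ht : ∀ r : R, r • α.one t = 0 → r = 0) : ∃ c : S, α.trace (α.one t * c) = 1 := by
  obtain ⟨m, x, y, hxy⟩ := hα.2.2
  -- I is the ideal tr(S_t) of R, and N below is S_t with its finite generating set 1_t x_i. The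
  -- dual basis formula gives N = I N, and the goal is 1 ∈ I.
  let I : Ideal R :=
    { carrier := {r | ∃ c : S, algebraMap R S r = α.trace (α.one t * c)}
      add_mem' := by
        rintro a b ⟨c, hc⟩ ⟨d, hd⟩
        exact ⟨c + d, by rw [map_add, hc, hd, mul_add, map_add]⟩
      zero_mem' := ⟨0, by simp⟩
      smul_mem' := by
        rintro r a ⟨c, hc⟩
        exact ⟨r • c, by rw [smul_eq_mul, map_mul, hc, mul_smul_comm, map_smul, Algebra.smul_def]⟩ }
  let N : Submodule R S := Submodule.span R (Set.range fun i => α.one t * x i)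
  have hN : N.FG := Submodule.fg_span (Set.finite_range _)
  have key : ∀ s : S, α.one t * s = s → s ∈ I • N := by
    intro s hs
    have h := α.sum_mul_trace hxy s
    rw [← hs, ← h, Finset.mul_sum]
    refine Submodule.sum_mem _ fun i _ => ?_
    obtain ⟨r, hr⟩ := α.exists_trace_eq_algebraMap hα (y i * s)
    have : α.one t * (x i * α.trace (y i * s)) = r • (α.one t * x i) := by
      rw [← hr, Algebra.smul_def]; ring
    rw [this]
    refine Submodule.smul_mem_smul ⟨y i * s, ?_⟩ (Submodule.subset_span ⟨i, rfl⟩)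
    rw [hr, mul_left_comm, hs]
  have hle : N ≤ I • N := by
    refine Submodule.span_le.2 ?_
    rintro _ ⟨i, rfl⟩
    exact key _ (by rw [← mul_assoc, (α.idem t).eq])
  obtain ⟨r, hr, hr'⟩ := Submodule.exists_sub_one_mem_and_smul_eq_zero_of_fg_of_le_smul I N hN hle
  -- Nakayama provides r ≡ 1 mod I with r N = 0. In particular r kills 1_t, so r = 0 by faithfulness
  -- and -1 ∈ I.
  have h0 : r = 0 := ht r (hr' _ (Submodule.smul_le_right (key _ (α.idem t).eq)))
  rw [h0, zero_sub] at hr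
  obtain ⟨c, hc⟩ := I.neg_mem_iff.1 hr
  exact ⟨c, by rw [← hc, map_one]⟩

end Trace

/-! ### Identification of E(S, α) with the trivial extension -/

section Hat

variable {R G S : Type u} [CommRing R] [CommGroup G] [CommRing S] [Algebra R S]
  (α : UnitalPartialAction R G S)

theorem hat_ext {a b : α.Hat} (h : ∀ t, (a t).1 = (b t).1) : a = b :=
  funext fun t => Subtype.ext (h t)

theorem hat_mul_one (a : α.Hat) (t : G) : (a t).1 * α.one t = (a t).1 :=
  ((Subsemigroup.mem_corner_iff (α.idem t)).1 (a t).2).2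

theorem hat_one_apply (t : G) : ((1 : α.Hat) t).1 = α.one t := rfl

theorem hat_mul_apply (a b : α.Hat) (t : G) : ((a * b) t).1 = (a t).1 * (b t).1 := rfl

theorem gamma_one (p : G × G) (t : G) :
    (α.gamma.one p t).1 = α.one (p.2⁻¹ * t) * α.one p.1 * α.one t := by
  have h := α.gamma_tot p 1 t
  rw [tot_one] at h
  rw [h, hat_one_apply, tot_one_mul, mul_inv, mul_assoc p.1⁻¹, mul_inv_cancel_left]

/-- For (h, h⁻¹) the index shift is by h h⁻¹ = 1, so invariance under δG is a separate condition on
each coordinate. -/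
theorem mem_E_iff (a : α.Hat) : a ∈ α.gamma.invariants (delta G) ↔
    ∀ h t, α.tot h (a t).1 * α.one t = (a t).1 * (α.one (h * t) * α.one h) := by
  have key : ∀ h, α.gamma.tot (h, h⁻¹) a = a * α.gamma.one (h, h⁻¹) ↔
      ∀ t, α.tot h (a t).1 * α.one t = (a t).1 * (α.one (h * t) * α.one h) := by
    intro h
    rw [funext_iff]
    refine forall_congr' fun t => ?_
    refine Subtype.ext_iff.trans ?_
    rw [gamma_tot, hat_mul_apply, gamma_one]
    rw [mul_inv_cancel, inv_one, one_mul, inv_inv, mul_comm (_ * _) (α.one t), ← mul_assoc (a t).1, hat_mul_one]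
  constructor
  · intro ha h
    exact (key h).1 (ha _ ⟨h, rfl⟩)
  · rintro ha _ ⟨h, rfl⟩
    exact (key h).2 (ha h)

/-- The map `∏_t R → Ŝ`, `r ↦ (r_t 1_t)_t`. -/
def constHat : (G → R) →ₐ[R] α.Hat :=
  AlgHom.pi fun t => (Algebra.ofId R (α.idem t).Corner).comp (Pi.evalAlgHom R (fun _ => R) t)

theorem constHat_apply (r : G → R) (t : G) : (α.constHat r t).1 = r t • α.one t := by
  show α.one t * algebraMap R S (r t) * α.one t = _
  rw [Algebra.smul_def]
  linear_combination algebraMap R S (r t) * (α.idem t).eq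

theorem constHat_mem (r : G → R) : α.constHat r ∈ α.gamma.invariants (delta G) := by
  rw [mem_E_iff]
  intro h t
  rw [constHat_apply, map_smul, tot_one_mul, smul_mul_assoc, smul_mul_assoc, mul_comm (α.one t)]

/-- An element of trace 1 in S_t forces the invariant coordinate a_t to be a scalar multiple of 1_t,
the scalar being tr(a_t c_t). -/
theorem mem_range_constHat (hα : α.IsPartialGalois) [Finite G]
    (hann : ∀ (g : G) (r : R), r • α.one g = 0 → r = 0) {a : α.Hat}
    (ha : a ∈ α.gamma.invariants (delta G)) : ∃ r, α.constHat r = a := by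
  cases nonempty_fintype G
  choose c hc using fun t => α.exists_trace_eq_one hα t (hann t)
  choose r hr using fun t => α.exists_trace_eq_algebraMap hα ((a t).1 * c t)
  refine ⟨r, α.hat_ext fun t => ?_⟩
  rw [constHat_apply, Algebra.smul_def, hr]
  have h1 : (a t).1 * α.trace (α.one t * c t) = (a t).1 := by rw [hc, mul_one]
  refine Eq.trans ?_ h1
  rw [trace_apply, trace_apply, Finset.sum_mul, Finset.mul_sum]
  refine Finset.sum_congr rfl fun h _ => ?_
  -- Since α_h(1_t 1_{h⁻¹}) = 1_{ht} 1_h, invariance under (h, h⁻¹) matches the two sums term by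
  -- term.
  rw [tot_mul, tot_mul, tot_one_mul]
  linear_combination α.tot h (c t) * (α.mem_E_iff a).1 ha h t

theorem constHat_injective (hann : ∀ (g : G) (r : R), r • α.one g = 0 → r = 0) :
    Function.Injective α.constHat := by
  refine (injective_iff_map_eq_zero _).2 fun r hr => funext fun t => hann t _ ?_
  rw [← constHat_apply, hr]; rfl

/-- Scalars are fixed by α, so only the index moves, and the shift depends on p only through p.1 *
p.2, that is, through its coset modulo δG. -/
theorem gamma_tot_constHat (p : G × G) (r : G → R) :
    α.gamma.tot p (α.constHat r)
      = α.constHat (fun t => r ((p.1 * p.2)⁻¹ * t)) * α.gamma.one p := by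
  refine α.hat_ext fun t => ?_
  rw [gamma_tot, constHat_apply, hat_mul_apply, constHat_apply, gamma_one, map_smul, tot_one_mul,
    mul_inv, mul_assoc, mul_inv_cancel_left, smul_mul_assoc, smul_mul_assoc]
  congr 1
  linear_combination (-(α.one (p.2⁻¹ * t) * α.one p.1)) * (α.idem t).eq

variable [Finite G]

/-- The pairs (h, l) and (h l, 1) differ by (l⁻¹, l) ∈ δG. -/
theorem mem_cosetList_toDelta (g : G) (p : G × G) :
    p ∈ cosetList (toDelta G g) ↔ p.1 * p.2 = g := by
  rw [mem_cosetList]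
  show (QuotientGroup.mk p : (G × G) ⧸ delta G) = QuotientGroup.mk (g, 1) ↔ _
  rw [QuotientGroup.eq]
  constructor
  · rintro ⟨h, hh⟩
    have h1 := congrArg Prod.fst hh
    have h2 := congrArg Prod.snd hh
    simp only [Prod.fst_mul, Prod.snd_mul, Prod.fst_inv, Prod.snd_inv, mul_one, inv_inj] at h1 h2
    rw [h2, ← h1, mul_inv_cancel_left]
  · rintro rfl
    exact ⟨p.2, Prod.ext (by simp) (by simp)⟩

theorem descend_tot {S : Type u} [CommRing S] [Algebra R S]
    (θ : UnitalPartialAction R (G × G) S) (g : G) (x : θ.invariants (delta G)) :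
    (θ.descend.tot g x).1 = θ.glue (cosetList (toDelta G g)) x.1 := by
  rw [descend, comap, ofTotal_tot]
  exact quot_tot _ _ _

/-- This is globality of γ̃. In coordinate t, the pairs in the coset of g contribute enough
idempotents to cover all α_k(1_{g t⁻¹} 1_{k⁻¹}) inside S_t, and an element of trace 1 in S_{g t⁻¹}
shows that these cover 1_t. -/
theorem gamma_glue_one (hα : α.IsPartialGalois)
    (hann : ∀ (g : G) (r : R), r • α.one g = 0 → r = 0) (g : G) :
    α.gamma.glue (cosetList (toDelta G g)) 1 = 1 := by
  cases nonempty_fintype G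
  refine α.hat_ext fun t => ?_
  obtain ⟨c, hc⟩ := α.exists_trace_eq_one hα (g * t⁻¹) (hann _)
  set w := α.gamma.glue (cosetList (toDelta G g)) 1 with hw
  have key : ∀ k, ((w t).1 - α.one t) * α.tot k (α.one (g * t⁻¹)) = 0 := by
    intro k
    -- The pair is chosen so that its idempotent has t-component 1_k 1_{k t⁻¹ g} 1_t, which is
    -- α_k(1_{g t⁻¹} 1_{k⁻¹}) 1_t.
    have hk : ((k * t⁻¹ * g, t * k⁻¹) : G × G) ∈ cosetList (toDelta G g) := by
      rw [mem_cosetList_toDelta]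
      calc k * t⁻¹ * g * (t * k⁻¹) = (k * k⁻¹) * (t * t⁻¹) * g := by ac_rfl
        _ = g := by simp
    have h := congrArg (fun a : α.Hat => (a t).1) (α.gamma.glue_one_mul_one hk)
    simp only [hat_mul_apply, gamma_one] at h
    rw [← hw] at h
    have e : (t * k⁻¹)⁻¹ * t = k := by simp
    have e' : k * (g * t⁻¹) = k * t⁻¹ * g := by ac_rfl
    rw [e] at h
    rw [tot_one_mul, e']
    have h' := α.hat_mul_one w t
    linear_combination h - (α.one k * α.one (k * t⁻¹ * g)) * h'
  have h0 : ((w t).1 - α.one t) * α.trace (α.one (g * t⁻¹) * c) = 0 := by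
    rw [trace_apply, Finset.mul_sum]
    refine Finset.sum_eq_zero fun k _ => ?_
    rw [tot_mul, ← mul_assoc, key, zero_mul]
  rw [hc, mul_one] at h0
  exact sub_eq_zero.1 h0

theorem rho_iso_gammaE (hα : α.IsPartialGalois)
    (hann : ∀ (g : G) (r : R), r • α.one g = 0 → r = 0) : (rho R G).Iso α.gammaE := by
  refine (iso_iff _ _).2 ⟨AlgEquiv.ofBijective
    (α.constHat.codRestrict (α.gamma.invariants (delta G)) α.constHat_mem) ⟨?_, ?_⟩, ?_⟩
  · intro r s h
    exact α.constHat_injective hann (congrArg Subtype.val h)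
  · rintro ⟨a, ha⟩
    obtain ⟨r, hr⟩ := α.mem_range_constHat hα hann ha
    exact ⟨r, Subtype.ext hr⟩
  · intro g r
    refine Subtype.ext ?_
    refine Eq.trans ?_ (descend_tot α.gamma g _).symm
    show α.constHat ((rho R G).tot g r) = α.gamma.glue _ (α.constHat r)
    have hr : (rho R G).tot g r = fun t => r (g⁻¹ * t) := funext (rho_tot g r)
    rw [hr]
    -- Both sides are multiples of the glued idempotent, so they may be compared after
    -- multiplication by each idempotent of the coset, where γ_p is a plain translation.
    refine α.gamma.glue_ext (L := cosetList (toDelta G g)) ?_ (glue_mul_glue_one _ _ _) ?_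
    · rw [α.gamma_glue_one hα hann, mul_one]
    · intro p hp
      rw [α.gamma.glue_mul_one (α.constHat_mem r) hp fun q hq =>
        ((mem_cosetList _ q).1 hq).trans ((mem_cosetList _ p).1 hp).symm, gamma_tot_constHat,
        (mem_cosetList_toDelta g p).1 hp]

end Hat

/-! ### The trivial extension is global and Galois -/

section Rho

variable {R G : Type u} [CommRing R] [CommGroup G]

theorem rho_one (g : G) : (rho R G).one g = 1 := by
  rw [← tot_one]
  ext t
  rw [rho_tot]; rfl

theorem rho_isGlobal : (rho R G).IsGlobal := fun g => by
  rw [D_eq, rho_one, Ideal.span_singleton_one]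

theorem rho_isPartialGalois [Finite G] : (rho R G).IsPartialGalois := by
  classical
  cases nonempty_fintype G
  refine ⟨fun r s h => congrFun h 1, fun s => ⟨fun hs => ⟨s 1, ?_⟩, ?_⟩, Fintype.card G,
    fun i => Pi.single ((Fintype.equivFin G).symm i) 1,
    fun i => Pi.single ((Fintype.equivFin G).symm i) 1, fun g => ?_⟩
  · ext t
    -- Translation by t compares the values at 1 and t, so an invariant function is constant.
    have h := congrFun (hs t trivial) t
    rw [rho_tot, rho_one, mul_one, inv_mul_cancel] at h
    exact h
  · rintro ⟨r, rfl⟩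
    exact Subalgebra.algebraMap_mem _ r
  · have key : ∑ i, (Pi.single ((Fintype.equivFin G).symm i) 1 : G → R)
        * (rho R G).tot g (Pi.single ((Fintype.equivFin G).symm i) 1)
        = fun _ => if g = 1 then 1 else 0 := by
      rw [(Fintype.equivFin G).symm.sum_comp
        fun k => (Pi.single k 1 : G → R) * (rho R G).tot g (Pi.single k 1)]
      ext t
      rw [Finset.sum_apply, Finset.sum_eq_single t]
      · rw [Pi.mul_apply, rho_tot, Pi.single_eq_same, one_mul, Pi.single_apply]
        simp
      · intro k _ hk
        rw [Pi.mul_apply, Pi.single_eq_of_ne hk.symm, zero_mul]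
      · simp
    constructor
    · intro hg
      rw [key]; simp only [hg, if_true]; rfl
    · intro hg
      rw [key]; simp only [hg, if_false]; rfl

end Rho

/-! ### Transfer of properties along isomorphisms -/

section Iso

variable {R G S T : Type u} [CommRing R] [Group G] [CommRing S] [Algebra R S] [CommRing T]
  [Algebra R T] {α : UnitalPartialAction R G S} {β : UnitalPartialAction R G T}

theorem Iso.isGlobal (h : α.Iso β) (hα : α.IsGlobal) : β.IsGlobal := by
  obtain ⟨φ, hD, -⟩ := h
  intro g
  refine (Ideal.eq_top_iff_one _).2 ?_
  rw [← map_one φ, ← hD, hα g]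
  trivial

theorem Iso.isPartialGalois (h : α.Iso β) (hα : α.IsPartialGalois) : β.IsPartialGalois := by
  obtain ⟨φ, h⟩ := (iso_iff _ _).1 h
  have hone : ∀ g, φ (α.one g) = β.one g := fun g => by rw [← tot_one, h, map_one, tot_one]
  obtain ⟨hinj, hinv, m, x, y, hxy⟩ := hα
  refine ⟨?_, fun t => ?_, m, fun i => φ (x i), fun i => φ (y i), fun g => ?_⟩
  · intro r s hrs
    rw [← φ.commutes, ← φ.commutes] at hrs
    exact hinj (φ.injective hrs)
  · have h1 : t ∈ β.invariants ⊤ ↔ φ.symm t ∈ α.invariants ⊤ := by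
      refine forall_congr' fun g => imp_congr_right fun _ => ?_
      rw [← φ.injective.eq_iff, h, map_mul, hone, φ.apply_symm_apply]
    rw [h1, hinv]
    refine exists_congr fun r => ?_
    rw [← φ.injective.eq_iff, φ.apply_symm_apply, φ.commutes]
  · simp_rw [← h, ← map_mul, ← map_sum]
    exact ⟨fun hg => by rw [(hxy g).1 hg, map_one], fun hg => by rw [(hxy g).2 hg, map_zero]⟩

end Iso

/-! ### Interchanging the two factors of G × G -/

section Swap

variable {R G S : Type u} [CommRing R] [CommGroup G] [CommRing S] [Algebra R S]

/-- The partial action of `G × G` with the two factors interchanged. -/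
def swap (θ : UnitalPartialAction R (G × G) S) : UnitalPartialAction R (G × G) S :=
  θ.comap (MulEquiv.prodComm : G × G ≃* G × G).toMonoidHom

theorem swap_tot (θ : UnitalPartialAction R (G × G) S) (p : G × G) (s : S) :
    θ.swap.tot p s = θ.tot p.swap s := by
  rw [swap, comap, ofTotal_tot]; rfl

theorem swap_glue (θ : UnitalPartialAction R (G × G) S) (L : List (G × G)) (s : S) :
    θ.swap.glue L s = θ.glue (L.map Prod.swap) s := by
  induction L with
  | nil => simp [glue]
  | cons p L ih => rw [List.map_cons, glue_cons, glue_cons, ih, ← tot_one, ← tot_one, swap_tot,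
      swap_tot]

theorem swap_invariants (θ : UnitalPartialAction R (G × G) S) :
    θ.swap.invariants (delta G) = θ.invariants (delta G) := by
  have hone : ∀ p, θ.swap.one p = θ.one p.swap := fun p => by
    rw [← tot_one, swap_tot, tot_one]
  ext s
  constructor
  · rintro hs _ ⟨g, rfl⟩
    have h := hs (g⁻¹, g) ⟨g⁻¹, by simp⟩
    rwa [swap_tot, hone] at h
  · rintro hs _ ⟨g, rfl⟩
    rw [swap_tot, hone]
    exact hs (g⁻¹, g) ⟨g⁻¹, by simp⟩

/-- `δG` is stable under the swap, which induces the identity on `G ≃ (G × G) ⧸ δG`. -/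
theorem swap_descend_iso [Finite G] (θ : UnitalPartialAction R (G × G) S) :
    θ.swap.descend.Iso θ.descend := by
  refine (iso_iff _ _).2 ⟨Subalgebra.equivOfEq _ _ θ.swap_invariants, fun g s => Subtype.ext ?_⟩
  refine Eq.trans ?_ (descend_tot θ g _).symm
  refine (descend_tot θ.swap g s).trans ?_
  rw [swap_glue]
  have hs : s.1 ∈ θ.invariants (delta G) := θ.swap_invariants ▸ s.2
  -- Interchange preserves the product p.1 * p.2, so the swapped list enumerates the same coset, and
  -- gluing on invariants does not depend on the enumeration.
  refine θ.glue_congr hs (q := toDelta G g) (fun p => ?_) (mem_cosetList _)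
  rw [← mem_cosetList, mem_cosetList_toDelta, List.mem_map]
  constructor
  · rintro ⟨q, hq, rfl⟩
    rw [mem_cosetList_toDelta] at hq
    rw [← hq]
    exact mul_comm _ _
  · intro hp
    exact ⟨p.swap, (mem_cosetList_toDelta _ _).2 (by rw [← hp]; exact mul_comm _ _),
      Prod.swap_swap p⟩

end Swap

/-! ### The isomorphism between S ⊗ S and Ŝ -/

section TensorHat

variable {R G S : Type u} [CommRing R] [CommGroup G] [CommRing S] [Algebra R S]
  (α : UnitalPartialAction R G S)

/-- The canonical map `S ⊗ S → Ŝ`, `x ⊗ y ↦ (α_t(x 1_{t⁻¹}) y)_t`. -/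
noncomputable def tensorToHat : S ⊗[R] S →ₐ[R] α.Hat :=
  AlgHom.pi fun t => Algebra.TensorProduct.lift
    (AlgHom.ofLinearMap (R := R) (A := S) (B := (α.idem t).Corner)
      { toFun := fun x => ⟨α.one t * α.tot t x * α.one t, _, rfl⟩
        map_add' := fun x y => Subtype.ext (by
          show α.one t * α.tot t (x + y) * α.one t
            = α.one t * α.tot t x * α.one t + α.one t * α.tot t y * α.one t
          rw [map_add]; ring)
        map_smul' := fun r x => Subtype.ext (by
          show α.one t * α.tot t (r • x) * α.one t = r • (α.one t * α.tot t x * α.one t)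
          rw [map_smul]; simp) }
      (Subtype.ext (by
        show α.one t * α.tot t 1 * α.one t = α.one t
        rw [tot_one, (α.idem t).eq, (α.idem t).eq]))
      (fun x y => Subtype.ext (by
        show α.one t * α.tot t (x * y) * α.one t
          = (α.one t * α.tot t x * α.one t) * (α.one t * α.tot t y * α.one t)
        rw [tot_mul]
        linear_combination (-(α.tot t x * α.tot t y) * (α.one t * α.one t + α.one t))
          * (α.idem t).eq)))
    (AlgHom.ofLinearMap (R := R) (A := S) (B := (α.idem t).Corner)
      { toFun := fun x => ⟨α.one t * x * α.one t, _, rfl⟩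
        map_add' := fun x y => Subtype.ext (by
          show α.one t * (x + y) * α.one t = α.one t * x * α.one t + α.one t * y * α.one t
          ring)
        map_smul' := fun r x => Subtype.ext (by
          show α.one t * (r • x) * α.one t = r • (α.one t * x * α.one t)
          simp) }
      (Subtype.ext (by
        show α.one t * 1 * α.one t = α.one t
        rw [mul_one, (α.idem t).eq]))
      (fun x y => Subtype.ext (by
        show α.one t * (x * y) * α.one t = (α.one t * x * α.one t) * (α.one t * y * α.one t)
        linear_combination (-(x * y) * (α.one t * α.one t + α.one t)) * (α.idem t).eq)))
    (fun _ _ => Commute.all _ _)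

theorem tensorToHat_tmul (x y : S) (t : G) :
    (α.tensorToHat (x ⊗ₜ y) t).1 = α.tot t x * y := by
  have h : (α.tensorToHat (x ⊗ₜ y) t).1
      = (α.one t * α.tot t x * α.one t) * (α.one t * y * α.one t) := rfl
  rw [h]
  linear_combination (α.one t * α.one t * α.one t * y + α.one t * α.one t * y + α.one t * y + y)
    * α.tot_mul_self t x

/-- The swap appears because γ_{(h, l)} applies α_h, while here α acts on the second tensor factor.
The first factor, acted on through α*, only contributes to the index shift. -/
theorem tensorToHat_tot (p : G × G) (z : S ⊗[R] S) :
    α.tensorToHat ((α.star.tensor α).tot p z) = α.gamma.swap.tot p (α.tensorToHat z) := by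
  rw [swap_tot, tensor, ofTotal_tot]
  induction z using TensorProduct.induction_on with
  | zero => simp
  | add a b ha hb => simp only [map_add, ha, hb]
  | tmul x y =>
    refine α.hat_ext fun t => ?_
    rw [gamma_tot, TensorProduct.map_tmul, tensorToHat_tmul, tensorToHat_tmul, star, ofTotal_tot,
      tot_mul, tot_tot, tot_tot, Prod.fst_swap, Prod.snd_swap, mul_inv, mul_assoc p.2⁻¹,
      mul_inv_cancel_left, mul_comm p.1⁻¹ t]
    linear_combination (-α.tot (t * p.1⁻¹) x * α.one t) * α.tot_mul_self p.2 y

theorem tensorToHat_surjective [Finite G] (hα : α.IsPartialGalois) :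
    Function.Surjective α.tensorToHat := by
  cases nonempty_fintype G
  obtain ⟨m, x, y, hxy⟩ := hα.2.2
  intro a
  -- The inclusion S_t → S need not preserve 1, but additivity suffices to pass sums through it.
  have hcoe : ∀ t, ∃ f : α.Hat →+ S, ∀ b, f b = (b t).1 := fun t =>
    ⟨{ toFun := fun b => (b t).1, map_zero' := rfl, map_add' := fun _ _ => rfl }, fun _ => rfl⟩
  -- This is the explicit inverse. In coordinate t the summand of g is α_g(∑ x_i α_{g⁻¹t}(y_i)) a_g,
  -- suppressing idempotents, which vanishes unless g = t.
  refine ⟨∑ g, ∑ i, y i ⊗ₜ[R] (α.tot g (x i) * (a g).1), α.hat_ext fun t => ?_⟩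
  obtain ⟨f, hf⟩ := hcoe t
  rw [← hf, map_sum, map_sum, Finset.sum_eq_single t]
  · rw [map_sum, map_sum]
    simp_rw [hf, tensorToHat_tmul, ← mul_assoc, ← tot_mul, mul_comm (y _)]
    rw [← Finset.sum_mul, ← map_sum]
    have h := (hxy 1).1 rfl
    simp_rw [tot_id] at h
    rw [h, tot_one, mul_comm, hat_mul_one]
  · intro g _ hg
    rw [map_sum, map_sum]
    simp_rw [hf, tensorToHat_tmul, ← mul_assoc]
    have h := congrArg (α.tot g) ((hxy (g⁻¹ * t)).2 (by rwa [Ne, inv_mul_eq_one]))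
    simp_rw [map_sum, tot_mul, tot_tot, mul_inv_cancel_left, map_zero] at h
    have h' : ∀ i, α.tot t (y i) * α.tot g (x i) = α.tot g (x i) * (α.tot t (y i) * α.one g) :=
      fun i => by linear_combination (-α.tot t (y i)) * α.tot_mul_self g (x i)
    simp_rw [h']
    rw [← Finset.sum_mul, h, zero_mul]
  · simp

theorem tensorToHat_injective [Finite G] (hα : α.IsPartialGalois) :
    Function.Injective α.tensorToHat := by
  cases nonempty_fintype G
  obtain ⟨m, x, y, hxy⟩ := hα.2.2
  -- The inverse formula from surjectivity is also a left inverse: on u ⊗ v the sum over g assembles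
  -- tr(x_i u), a scalar that crosses the tensor sign, and the dual basis formula with x and y
  -- exchanged recovers u.
  have h : ∀ z, ∑ g, ∑ i, y i ⊗ₜ[R] (α.tot g (x i) * (α.tensorToHat z g).1) = z := by
    intro z
    induction z using TensorProduct.induction_on with
    | zero =>
      have h' : ∀ g, (α.tensorToHat 0 g).1 = 0 := fun g => by rw [map_zero]; rfl
      simp_rw [h', mul_zero, TensorProduct.tmul_zero, Finset.sum_const_zero]
    | add a b ha hb =>
      have h' : ∀ g, (α.tensorToHat (a + b) g).1
          = (α.tensorToHat a g).1 + (α.tensorToHat b g).1 := fun g => by rw [map_add]; rfl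
      simp_rw [h', mul_add, TensorProduct.tmul_add, Finset.sum_add_distrib]
      rw [ha, hb]
    | tmul u v =>
      choose r hr using fun i => α.exists_trace_eq_algebraMap hα (x i * u)
      have h' : ∀ i, ∑ g, y i ⊗ₜ[R] (α.tot g (x i) * (α.tensorToHat (u ⊗ₜ v) g).1)
          = (y i * α.trace (x i * u)) ⊗ₜ[R] v := fun i => by
        simp_rw [tensorToHat_tmul, ← mul_assoc, ← tot_mul]
        rw [← TensorProduct.tmul_sum, ← Finset.sum_mul, ← trace_apply, ← hr, ← Algebra.smul_def,
          TensorProduct.tmul_smul, mul_comm, ← Algebra.smul_def, TensorProduct.smul_tmul']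
      rw [Finset.sum_comm]
      simp_rw [h']
      rw [← TensorProduct.sum_tmul, α.sum_mul_trace (α.galois_coords_symm hxy)]
  intro z w hzw
  rw [← h z, hzw, h]

theorem star_par_iso_gammaE [Finite G] (hα : α.IsPartialGalois) :
    (α.star.par α).Iso α.gammaE := by
  have h : (α.star.tensor α).Iso α.gamma.swap := (iso_iff _ _).2
    ⟨AlgEquiv.ofBijective α.tensorToHat ⟨α.tensorToHat_injective hα, α.tensorToHat_surjective hα⟩,
      α.tensorToHat_tot⟩
  exact (PAct.setoid R G).trans (a := ⟨_, α.star.par α⟩) (b := ⟨_, α.gamma.swap.descend⟩)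
    (c := ⟨_, α.gammaE⟩) (descend_iso h) (swap_descend_iso _)

end TensorHat

/-! ### Classes and the proposition -/

section Classes

variable {R G S T : Type u} [CommRing R] [CommGroup G] [CommRing S] [Algebra R S] [CommRing T]
  [Algebra R T] {α : UnitalPartialAction R G S} {β : UnitalPartialAction R G T}

theorem Iso.cls_eq (h : α.Iso β) : α.cls = β.cls := Quotient.sound h

theorem idemClass_eq_rho [Finite G] (hα : α.IsPartialGalois)
    (hann : ∀ (g : G) (r : R), r • α.one g = 0 → r = 0) : idemClass α = (rho R G).cls :=
  (α.rho_iso_gammaE hα hann).cls_eq.symm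

end Classes

end UnitalPartialAction

theorem proposition6p4 {R G S : Type u} [CommRing R] [CommGroup G] [Finite G] [CommRing S]
    [Algebra R S] (α : UnitalPartialAction R G S) (hα : α.IsPartialGalois)
    (hann : ∀ (g : G) (r : R), r • α.one g = 0 → r = 0) :
    (α.gammaE.IsPartialGalois ∧ α.gammaE.IsGlobal) ∧
      idemClass α = idemClass (UnitalPartialAction.rho R G) ∧
      α.cls ∈ Tcomp (idemClass (UnitalPartialAction.rho R G)) := by
  have hiso := α.rho_iso_gammaE hα hann
  have hI : idemClass α = idemClass (UnitalPartialAction.rho R G) := by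
    rw [UnitalPartialAction.idemClass_eq_rho hα hann,
      -- E_G(R) satisfies the same hypotheses: all its idempotents are 1, and evaluation at one
      -- point recovers r.
      UnitalPartialAction.idemClass_eq_rho UnitalPartialAction.rho_isPartialGalois fun g r hr => by
        rw [UnitalPartialAction.rho_one] at hr
        simpa using congrFun hr 1]
  refine ⟨⟨hiso.isPartialGalois UnitalPartialAction.rho_isPartialGalois,
    hiso.isGlobal UnitalPartialAction.rho_isGlobal⟩, hI, ⟨⟨S, α⟩, hα, rfl⟩, ?_⟩
  -- Star and product of classes are computed on representatives, so what remains is the class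
  -- equality of `α.star.par α` and `α.gammaE`.
  rw [← hI]
  exact (α.star_par_iso_gammaE hα).cls_eq
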